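/- Let $G$ be a Polish group (with its Borel $\sigma$-algebra) and let $(X,\lambda)$ be a standard $\sigma$-finite space, i.e. a standard Borel space $X$ with a nonzero atomless $\sigma$-finite measure $\lambda$. Let $\alpha$ be a boolean measure-preserving $G$-action on $(X,\lambda)$, i.e. a Borel map $\alpha:G\times X\to X$ such that for all $g,h\in G$ one has $\alpha(gh,x)=\alpha(g,\alpha(h,x))$ for $\lambda$-almost every $x\in X$, and such that for every $g\in G$ the map $\alpha(g,\cdot)$ is a measure-preserving bijection of $(X,\lambda)$. Call $f\in \mathrm L^\infty(X,\lambda)$ (complex-valued) $G$-continuous if $\|f-f\circ\alpha(g^{-1},\cdot)\|_\infty\to 0$ as $g\to e_G$, and let $\mathcal G\subseteq \mathrm L^\infty(X,\lambda)$ be the set of $G$-continuous functions. A measure on the Borel $\sigma$-algebra of a Hausdorff space is called Radon if it is finite on compact sets, inner regular on open sets (by compact sets), and outer regular on Borel sets (by open sets). Then the following are equivalent: (1) $\overline{\mathcal G\cap \mathrm L^1(X,\lambda)}^{\|\cdot\|_1}=\mathrm L^1(X,\lambda)$; (2) $\overline{\mathcal G\cap \mathrm L^2(X,\lambda)}^{\|\cdot\|_2}=\mathrm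 L^2(X,\lambda)$; (3) $\alpha$ admits a continuous Radon model: there are a locally compact Polish space $Y$, a Radon measure $\eta$ on $Y$, a continuous $\eta$-preserving action $\beta:G\times Y\to Y$, a conull Borel set $X_0\subseteq X$ and a measure-preserving Borel injection $\Phi:X_0\to Y$ (that is, $\Phi_*(\lambda|_{X_0})=\eta$) such that for every $g\in G$, for almost every $x\in X_0$, one has $\alpha(g,x)\in X_0$ and $\Phi(\alpha(g,x))=\beta(g,\Phi(x))$; (4) $X$ can be endowed with a locally compact Polish topology inducing its Borel structure such that $\lambda$ is Radon and there is a continuous $\lambda$-preserving action $\beta:G\times X\to X$ such that for every $g\in G$, $\beta(g,x)=\alpha(g,x)$ for almost every $x\in X$. -/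

import Mathlib

open MeasureTheory Filter Topology
open scoped ENNReal
universe u v

/-- A boolean measure-preserving action of `G` on `(X, μ)`: a Borel map `G × X → X` which
satisfies the action identity almost everywhere for each fixed pair of group elements, and each of
whose sections is a measure-preserving bijection of `(X, μ)`. -/
structure BooleanAction (G X : Type*) [Group G] [MeasurableSpace G] [MeasurableSpace X]
    (μ : Measure X) where
  /-- the underlying map `(g, x) ↦ α(g, x)` -/
  act : G → X → X
  measurable_act : Measurable (fun q : G × X => act q.1 q.2)
  act_mul_ae : ∀ g h : G, ∀ᵐ x ∂μ, act (g * h) x = act g (act h x)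
  bijective_act : ∀ g : G, Function.Bijective (act g)
  measurePreserving_act : ∀ g : G, MeasurePreserving (act g) μ μ

namespace BooleanAction

variable {G X Y : Type*} [Group G] [MeasurableSpace G] [MeasurableSpace X] [MeasurableSpace Y]
  {μ : Measure X} {η : Measure Y}

/-- The boolean action is a spatial one: the action identities hold everywhere. -/
def IsSpatial (α : BooleanAction G X μ) : Prop :=
  (∀ x : X, α.act 1 x = x) ∧ ∀ (g h : G) (x : X), α.act (g * h) x = α.act g (α.act h x)

/-- The spatial action is (jointly) continuous. -/
def IsContinuousSpatial [TopologicalSpace G] [TopologicalSpace X] (α : BooleanAction G X μ) :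
    Prop :=
  α.IsSpatial ∧ Continuous (fun q : G × X => α.act q.1 q.2)

/-- The element `f ∘ α(g⁻¹, ·)` of `L^∞(X, μ)`. -/
noncomputable def translate (α : BooleanAction G X μ) (g : G) (f : Lp ℂ ∞ μ) : Lp ℂ ∞ μ :=
  Lp.compMeasurePreserving (α.act g⁻¹) (α.measurePreserving_act g⁻¹) f

/-- The set of `G`-continuous functions: those `f ∈ L^∞(X, μ)` such that
`‖f - f ∘ α(g⁻¹, ·)‖_∞ → 0` as `g → 1`. -/
def gContinuous [TopologicalSpace G] (α : BooleanAction G X μ) : Set (Lp ℂ ∞ μ) :=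
  {f | Tendsto (fun g : G => ‖f - α.translate g f‖) (𝓝 1) (𝓝 0)}

/-- The intersection of the set of `G`-continuous functions with `L^p(X, μ)`, taken inside the
space of all measurable functions up to almost everywhere equality, as a subset of `L^p(X, μ)`. -/
def gContinuousInter [TopologicalSpace G] (α : BooleanAction G X μ) (p : ℝ≥0∞) :
    Set (Lp ℂ p μ) :=
  {h | ∃ f ∈ α.gContinuous, (f : X →ₘ[μ] ℂ) = (h : X →ₘ[μ] ℂ)}

/-- Two boolean actions are booleanly isomorphic: there is a measure-preserving Borel injection
`Φ : X₀ → Y`, defined on a conull Borel set `X₀ ⊆ X`, such that for every `g` the identity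
`Φ(α(g, x)) = β(g, Φ(x))` holds (and its left-hand side is defined) for almost every `x ∈ X₀`. -/
def BooleanlyIsomorphic (α : BooleanAction G X μ) (β : BooleanAction G Y η) : Prop :=
  ∃ (X₀ : Set X) (Φ : X₀ → Y), MeasurableSet X₀ ∧ μ X₀ᶜ = 0 ∧ Function.Injective Φ ∧
    MeasurePreserving Φ (μ.comap Subtype.val) η ∧
    ∀ g : G, ∀ᵐ x : X₀ ∂(μ.comap Subtype.val),
      ∃ hx : α.act g x ∈ X₀, Φ ⟨α.act g x, hx⟩ = β.act g (Φ x)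

end BooleanAction

/-- A boolean action admits a continuous Radon model: it is booleanly isomorphic to a continuous
measure-preserving action on a locally compact Polish space with a Radon measure.
`Measure.Regular` means: finite on compact sets, inner regular on open sets for compact sets, and
outer regular on Borel sets. -/
def BooleanAction.AdmitsContinuousRadonModel {G : Type v} {X : Type u} [Group G]
    [TopologicalSpace G] [MeasurableSpace G] [MeasurableSpace X] {μ : Measure X}
    (α : BooleanAction G X μ) : Prop :=
  ∃ (Y : Type u) (_ : TopologicalSpace Y) (_ : MeasurableSpace Y) (η : Measure Y)
    (β : BooleanAction G Y η),
    PolishSpace Y ∧ LocallyCompactSpace Y ∧ BorelSpace Y ∧ η.Regular ∧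
    β.IsContinuousSpatial ∧ α.BooleanlyIsomorphic β

/-- A boolean action on `(X, μ)` lifts to a continuous action on `X` itself: `X` carries a locally
compact Polish topology inducing its Borel structure, for which `μ` is Radon and for which there
is a continuous measure-preserving action whose sections agree with those of `α` up to null
sets. -/
def BooleanAction.LiftsToContinuousRadon {G X : Type*} [Group G]
    [TopologicalSpace G] [MeasurableSpace G] [MeasurableSpace X] {μ : Measure X}
    (α : BooleanAction G X μ) : Prop :=
  ∃ _ : TopologicalSpace X, PolishSpace X ∧ LocallyCompactSpace X ∧ BorelSpace X ∧ μ.Regular ∧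
    ∃ β : BooleanAction G X μ, β.IsContinuousSpatial ∧ ∀ g : G, β.act g =ᵐ[μ] α.act g

/-!
The way from density to a continuous model is a Gelfand-type construction. Approximating an
injective nowhere vanishing function of `L^p` gives a sequence of `G`-continuous functions `f n` in
`L^p` which separate almost all points, and which almost nowhere vanish simultaneously. For a dense
sequence `γ k` in `G`, put `Φ x = (f n (α(γ k, x)))_{n, k}`, and let `Y` be the nonzero part of the
support of `Φ_* μ`: the support is compact, so `Y` is locally compact, and by Markov's inequality
`Φ_* μ` is finite near every point of `Y`. The coordinate `(n, γ k)` of `g • y` has to be the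
would-be coordinate `(n, γ k g)` of `y`. It exists because `h ↦ f n ∘ α(h, ·)` is continuous in
`L^∞`: it takes values in the closed subspace of pull-backs of bounded continuous functions on `Y`,
since it does so on the dense sequence. The action identities hold almost everywhere, hence
everywhere since `Φ_* μ` has full support. Finally `Φ` is injective on a conull set, and a change on
a null set turns it into a Borel isomorphism, which carries the topology and the action back to `X`.

Conversely, on a continuous Radon model, compactly supported continuous functions are
`G`-continuous and dense in `L^p`.
-/

section StandardBorel

variable {X Y : Type*} [MeasurableSpace X] [StandardBorelSpace X] [MeasurableSpace Y]
  {μ : Measure X}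

theorem exists_subset_null_not_countable (μ : Measure X) [SFinite μ] {s : Set X}
    (hs : MeasurableSet s) (hsc : ¬ s.Countable) :
    ∃ N ⊆ s, MeasurableSet N ∧ μ N = 0 ∧ ¬ N.Countable := by
  have : StandardBorelSpace s := hs.standardBorel
  let e : s ≃ᵐ ℝ × ℝ := PolishSpace.measurableEquivOfNotCountable hsc not_countable
  let j : ℝ × ℝ → X := fun q => e.symm q
  have hj : MeasurableEmbedding j :=
    (MeasurableEmbedding.subtype_coe hs).comp e.symm.measurableEmbedding
  -- the uncountably many vertical lines are disjoint, so all but countably many are null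
  let line (t : ℝ) : Set X := j '' (Prod.fst ⁻¹' {t})
  have hline (t : ℝ) : MeasurableSet (line t) :=
    hj.measurableSet_image.2 (measurable_fst (measurableSet_singleton t))
  have hdisj : Pairwise (Function.onFun Disjoint line) := fun t t' htt' =>
    (Set.disjoint_image_iff hj.injective).2
      (Disjoint.preimage _ (Set.disjoint_singleton.2 htt'))
  obtain ⟨t, ht⟩ : ∃ t, t ∉ {t | 0 < μ (line t)} :=
    (Set.ne_univ_iff_exists_notMem _).1 fun h => Set.not_countable_univ
      (h ▸ Measure.countable_meas_pos_of_disjoint_iUnion hline hdisj)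
  refine ⟨line t, ?_, hline t, nonpos_iff_eq_zero.1 (not_lt.1 ht), fun hc => ?_⟩
  · rintro _ ⟨q, -, rfl⟩
    exact (e.symm q).2
  · have huniv : (fun r : ℝ => j (t, r)) ⁻¹' line t = Set.univ :=
      Set.eq_univ_of_forall fun r => ⟨(t, r), rfl, rfl⟩
    exact Set.not_countable_univ
      (huniv ▸ hc.preimage (hj.injective.comp (Prod.mk_right_injective t)))

variable [StandardBorelSpace Y]

theorem exists_measurableEquiv_eqOn {Φ : X → Y} (hΦ : Measurable Φ) {t : Set X}
    (ht : MeasurableSet t) (hinj : Set.InjOn Φ t) (htc : ¬ tᶜ.Countable)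
    (hΦt : ¬ (Φ '' t)ᶜ.Countable) : ∃ e : X ≃ᵐ Y, Set.EqOn e Φ t := by
  classical
  have := ht.standardBorel
  have hemb : MeasurableEmbedding (t.domRestrict Φ) :=
    (hΦ.comp measurable_subtype_coe).measurableEmbedding (Set.injOn_iff_injective.1 hinj)
  have hR : MeasurableSet (Set.range (t.domRestrict Φ)) := hemb.measurableSet_range
  rw [← Set.range_domRestrict] at hΦt
  have := ht.compl.standardBorel
  have := hR.compl.standardBorel
  refine ⟨(MeasurableEquiv.sumCompl ht).symm.trans ((MeasurableEquiv.sumCongr hemb.equivRange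
    (PolishSpace.measurableEquivOfNotCountable htc hΦt)).trans (MeasurableEquiv.sumCompl hR)),
    fun x hx => ?_⟩
  have hinl : (MeasurableEquiv.sumCompl ht).symm x = Sum.inl ⟨x, hx⟩ :=
    (MeasurableEquiv.symm_apply_eq _).2 rfl
  simp only [MeasurableEquiv.trans_apply, hinl]
  exact congrArg Subtype.val (hemb.equivRange_apply ⟨x, hx⟩)

theorem exists_measurableEquiv_ae_eq [SFinite μ] [NullSingletonClass μ] (hμ : μ ≠ 0) {Φ : X → Y}
    (hΦ : Measurable Φ) {s : Set X} (hs : s ∈ ae μ) (hinj : Set.InjOn Φ s) :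
    ∃ e : X ≃ᵐ Y, e =ᵐ[μ] Φ := by
  obtain ⟨t, ht, htm, hts⟩ := Eventually.exists_measurable_mem hs
  have htc : ¬ t.Countable := fun h => hμ <| Measure.measure_univ_eq_zero.1 <|
    (measure_congr (eventuallyEq_univ.2 ht)).symm.trans (h.measure_zero μ)
  -- removing an uncountable null set from `t` leaves room to extend to a bijection
  obtain ⟨N, hNt, hN, hN0, hNc⟩ := exists_subset_null_not_countable μ htm htc
  have hinjt : Set.InjOn Φ t := hinj.mono hts
  have hdisj : Disjoint (Φ '' N) (Φ '' (t \ N)) :=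
    Set.disjoint_sdiff_right.image hinjt hNt Set.sdiff_subset
  obtain ⟨e, he⟩ := exists_measurableEquiv_eqOn hΦ (htm.diff hN) (hinjt.mono Set.sdiff_subset)
    (fun h => hNc (h.mono Set.disjoint_sdiff_right.subset_compl_right))
    (fun h => hNc (Set.countable_of_injective_of_countable_image (hinjt.mono hNt)
      (h.mono hdisj.subset_compl_right)))
  refine ⟨e, ?_⟩
  filter_upwards [ht, measure_eq_zero_iff_ae_notMem.1 hN0] with x hx hxN
  exact he ⟨hx, hxN⟩

end StandardBorel

theorem exists_pos_measurable_memLp {X : Type*} [MeasurableSpace X] (μ : Measure X) [SigmaFinite μ]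
    {p : ℝ≥0∞} (hp0 : p ≠ 0) (hp : p ≠ ∞) :
    ∃ r : X → ℝ, Measurable r ∧ (∀ x, 0 < r x) ∧ MemLp r p μ := by
  obtain ⟨w, hw0, hwm, hw⟩ := exists_pos_lintegral_lt_of_sigmaFinite μ (ε := 1) one_ne_zero
  have hr0 (x : X) : 0 < (w x : ℝ) ^ p.toReal⁻¹ := Real.rpow_pos_of_pos (hw0 x) _
  have hrm : Measurable fun x => (w x : ℝ) ^ p.toReal⁻¹ := by fun_prop
  refine ⟨_, hrm, hr0, hrm.aestronglyMeasurable,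
    (eLpNorm_lt_top_iff_lintegral_rpow_enorm_lt_top hp0 hp).2 ?_⟩
  refine lt_of_eq_of_lt (lintegral_congr fun x => ?_) (hw.trans ENNReal.one_lt_top)
  rw [Real.enorm_eq_ofReal (hr0 x).le, ENNReal.ofReal_rpow_of_pos (hr0 x),
    Real.rpow_inv_rpow (w x).coe_nonneg (ENNReal.toReal_pos hp0 hp).ne', ENNReal.ofReal_coe_nnreal]

theorem exists_injective_ne_zero_memLp {X : Type*} [MeasurableSpace X] [StandardBorelSpace X]
    (μ : Measure X) [SigmaFinite μ] {p : ℝ≥0∞} (hp0 : p ≠ 0) (hp : p ≠ ∞) :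
    ∃ f : X → ℂ, Function.Injective f ∧ (∀ x, f x ≠ 0) ∧ MemLp f p μ := by
  obtain ⟨r, hrm, hr0, hr⟩ := exists_pos_measurable_memLp μ hp0 hp
  let v : X → unitInterval := unitInterval.sigmoid ∘ embeddingReal X
  have hv : MeasurableEmbedding v := measurableEmbedding_sigmoid_comp_embeddingReal X
  have : Measurable fun x => (v x : ℝ) := measurable_subtype_coe.comp hv.measurable
  have hre (x : X) : (r x + r x * v x * Complex.I : ℂ).re = r x := by simp
  have him (x : X) : (r x + r x * v x * Complex.I : ℂ).im = r x * v x := by simp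
  -- the ratio of the two parts is the injection `v`
  refine ⟨fun x => r x + r x * v x * Complex.I, fun x y hxy => ?_, fun x hx => ?_, ?_⟩
  · have hrxy : r x = r y := by simpa only [hre] using congrArg Complex.re hxy
    have hvxy : r x * v x = r y * v y := by simpa only [him] using congrArg Complex.im hxy
    rw [hrxy] at hvxy
    exact hv.injective (Subtype.ext (mul_left_cancel₀ (hr0 y).ne' hvxy))
  · exact (hr0 x).ne' (by simpa only [hre, Complex.zero_re] using congrArg Complex.re hx)
  · refine hr.of_le_mul (c := 2) (by fun_prop) (ae_of_all _ fun x => ?_)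
    calc ‖(r x + r x * v x * Complex.I : ℂ)‖ ≤ |r x| + |r x * v x| :=
          (Complex.norm_le_abs_re_add_abs_im _).trans_eq (by rw [hre, him])
      _ ≤ 2 * ‖r x‖ := by
          rw [abs_mul, abs_of_nonneg (v x).2.1, Real.norm_eq_abs]
          nlinarith [abs_nonneg (r x), (v x).2.2]


section LInfty

variable {X E : Type*} [MeasurableSpace X] {μ : Measure X} [NormedAddCommGroup E]

theorem ae_norm_le_norm_top (f : Lp E ∞ μ) : ∀ᵐ x ∂μ, ‖f x‖ ≤ ‖f‖ := by
  filter_upwards [ae_le_eLpNormEssSup (f := f) (μ := μ)] with x hx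
  rw [Lp.norm_def, ← toReal_enorm]
  exact ENNReal.toReal_mono (Lp.memLp f).eLpNorm_ne_top (by rwa [eLpNorm_exponent_top])

theorem norm_le_of_ae_norm_le_top {f : Lp E ∞ μ} {c : ℝ} (hc : 0 ≤ c) (h : ∀ᵐ x ∂μ, ‖f x‖ ≤ c) :
    ‖f‖ ≤ c := by
  rw [Lp.norm_def, eLpNorm_exponent_top]
  exact ENNReal.toReal_le_of_le_ofReal hc (eLpNormEssSup_le_of_ae_bound h)

variable {Y Z : Type*} [TopologicalSpace Y] [MeasurableSpace Y] {ν : Measure Y} {Φ : X → Y}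

theorem mem_of_ae_comp_mem [OpensMeasurableSpace Y] [ν.IsOpenPosMeasure]
    (hΦ : MeasurePreserving Φ μ ν) {C : Set Y} (hC : IsClosed C) (h : ∀ᵐ x ∂μ, Φ x ∈ C) (y : Y) :
    y ∈ C := by
  have hν : ∀ᵐ y ∂ν, y ∈ C := by
    rw [← hΦ.map_eq]
    exact (ae_map_iff hΦ.aemeasurable hC.measurableSet).2 h
  exact hC.closure_eq.le (Measure.dense_of_ae hν y)

theorem eq_of_ae_comp_eq [OpensMeasurableSpace Y] [ν.IsOpenPosMeasure] [TopologicalSpace Z]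
    [T2Space Z] (hΦ : MeasurePreserving Φ μ ν) {a b : Y → Z} (ha : Continuous a) (hb : Continuous b)
    (h : ∀ᵐ x ∂μ, a (Φ x) = b (Φ x)) : a = b :=
  funext (mem_of_ae_comp_mem hΦ (isClosed_eq ha hb) h)

variable [BorelSpace Y] [SecondCountableTopologyEither Y E]

/-- The pull-back `f ↦ f ∘ Φ` of bounded continuous functions to `L^∞`, along a measure-preserving
map `Φ`. -/
noncomputable def pullbackLinfty (hΦ : MeasurePreserving Φ μ ν)
    (f : BoundedContinuousFunction Y E) : Lp E ∞ μ :=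
  Lp.compMeasurePreserving Φ hΦ f.memLp_top.toLp

theorem coeFn_pullbackLinfty (hΦ : MeasurePreserving Φ μ ν) (f : BoundedContinuousFunction Y E) :
    pullbackLinfty hΦ f =ᵐ[μ] f ∘ Φ := by
  filter_upwards [Lp.coeFn_compMeasurePreserving f.memLp_top.toLp hΦ,
    hΦ.quasiMeasurePreserving.ae f.memLp_top.coeFn_toLp] with x h₁ h₂
  rw [pullbackLinfty, h₁, Function.comp_apply, h₂, Function.comp_apply]

theorem pullbackLinfty_sub (hΦ : MeasurePreserving Φ μ ν) (f g : BoundedContinuousFunction Y E) :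
    pullbackLinfty hΦ (f - g) = pullbackLinfty hΦ f - pullbackLinfty hΦ g :=
  (congrArg _ (MemLp.toLp_sub f.memLp_top g.memLp_top)).trans (map_sub _ _ _)

theorem norm_pullbackLinfty [ν.IsOpenPosMeasure] (hΦ : MeasurePreserving Φ μ ν)
    (f : BoundedContinuousFunction Y E) : ‖pullbackLinfty hΦ f‖ = ‖f‖ := by
  refine le_antisymm (norm_le_of_ae_norm_le_top (norm_nonneg f) ?_)
    ((f.norm_le (norm_nonneg _)).2 (mem_of_ae_comp_mem hΦ
      (C := {y | ‖f y‖ ≤ ‖pullbackLinfty hΦ f‖}) (isClosed_le (by fun_prop) (by fun_prop)) ?_))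
  · filter_upwards [coeFn_pullbackLinfty hΦ f] with x hx
    exact hx ▸ f.norm_coe_le_norm _
  · filter_upwards [coeFn_pullbackLinfty hΦ f, ae_norm_le_norm_top (pullbackLinfty hΦ f)]
      with x h₁ h₂
    rwa [h₁] at h₂

theorem isometry_pullbackLinfty [ν.IsOpenPosMeasure] (hΦ : MeasurePreserving Φ μ ν) :
    Isometry (pullbackLinfty (E := E) hΦ) :=
  Isometry.of_dist_eq fun f g => by
    rw [dist_eq_norm, ← pullbackLinfty_sub, norm_pullbackLinfty, dist_eq_norm]

theorem mem_range_pullbackLinfty [ν.IsOpenPosMeasure] (hΦ : MeasurePreserving Φ μ ν)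
    {f : Lp E ∞ μ} {c : Y → E} (hc : Continuous c) (h : c ∘ Φ =ᵐ[μ] f) :
    f ∈ Set.range (pullbackLinfty hΦ) := by
  have hbound : ∀ y, ‖c y‖ ≤ ‖f‖ :=
    mem_of_ae_comp_mem hΦ (C := {y | ‖c y‖ ≤ ‖f‖}) (isClosed_le (by fun_prop) (by fun_prop)) (by
      filter_upwards [h, ae_norm_le_norm_top f] with x h₁ h₂
      rwa [← h₁] at h₂)
  exact ⟨.ofNormedAddCommGroup c hc ‖f‖ hbound, Lp.ext ((coeFn_pullbackLinfty hΦ _).trans h)⟩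

end LInfty

section Support

variable {X Z : Type*} [MeasurableSpace X] {μ : Measure X} [MeasurableSpace Z] {F : X → Z}

theorem exists_measurable_subtype_ae_eq (hμ : μ ≠ 0) (hF : AEMeasurable F μ) {s : Set Z}
    (hs : ∀ᵐ x ∂μ, F x ∈ s) : ∃ Φ : X → s, Measurable Φ ∧ ∀ᵐ x ∂μ, (Φ x : Z) = F x := by
  have : NeBot (ae μ) := ae_neBot.2 hμ
  obtain ⟨F', hF', hF's, hFF'⟩ := hF.exists_ae_eq_range_subset hs (hs.exists.imp' F fun _ => id)
  exact ⟨fun x => ⟨F' x, hF's ⟨x, rfl⟩⟩, hF'.subtype_mk, hFF'.symm⟩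

variable [TopologicalSpace Z]

theorem ae_mem_support_map [HereditarilyLindelofSpace Z] (hF : AEMeasurable F μ) :
    ∀ᵐ x ∂μ, F x ∈ (μ.map F).support :=
  ae_of_ae_map hF Measure.support_mem_ae

theorem isOpenPosMeasure_map_of_subset_support [OpensMeasurableSpace Z] (hF : AEMeasurable F μ)
    {s : Set Z} (hs : s ⊆ (μ.map F).support) {Φ : X → s} (hΦ : AEMeasurable Φ μ)
    (hΦF : ∀ᵐ x ∂μ, (Φ x : Z) = F x) : (μ.map Φ).IsOpenPosMeasure := by
  refine ⟨fun U hU ⟨y, hy⟩ hU0 => ?_⟩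
  obtain ⟨V, hV, rfl⟩ := isOpen_induced_iff.1 hU
  rw [Measure.map_apply_of_aemeasurable hΦ hU.measurableSet] at hU0
  refine (Measure.mem_support_iff_forall _).1 (hs y.2) V (hV.mem_nhds hy) |>.ne' ?_
  rw [Measure.map_apply_of_aemeasurable hF hV.measurableSet, ← hU0]
  refine measure_congr ?_
  filter_upwards [hΦF] with x hx
  exact congrArg V hx.symm

theorem isCompact_support_map_of_ae_norm_le {I E : Type*} [Countable I] [NormedAddCommGroup E]
    [ProperSpace E] [MeasurableSpace E] [OpensMeasurableSpace E]
    {F : X → I → E} (hF : AEMeasurable F μ) {c : I → ℝ} (hc : ∀ i, ∀ᵐ x ∂μ, ‖F x i‖ ≤ c i) :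
    IsCompact (μ.map F).support := by
  let B : Set (I → E) := Set.univ.pi fun i => Metric.closedBall 0 (c i)
  have hB : IsClosed B := isClosed_set_pi fun i _ => Metric.isClosed_closedBall
  have hBm : MeasurableSet B := .univ_pi fun i => Metric.isClosed_closedBall.measurableSet
  refine (isCompact_univ_pi fun i => isCompact_closedBall _ _).of_isClosed_subset
    Measure.isClosed_support (Measure.support_subset_of_isClosed hB ((ae_map_iff hF hBm).2 ?_))
  filter_upwards [ae_all_iff.2 hc] with x hx i _
  exact mem_closedBall_zero_iff.2 (hx i)

theorem isLocallyFiniteMeasure_map_of_memLp {Y I E : Type*} [TopologicalSpace Y]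
    [MeasurableSpace Y] [OpensMeasurableSpace Y] [NormedAddCommGroup E] {Φ : X → Y}
    (hΦ : AEMeasurable Φ μ) {p : ℝ≥0∞} (hp0 : p ≠ 0) (hp : p ≠ ∞) {c : I → Y → E}
    (hc : ∀ i, Continuous (c i)) (hcp : ∀ i, MemLp (c i ∘ Φ) p μ) (hne : ∀ y, ∃ i, c i y ≠ 0) :
    IsLocallyFiniteMeasure (μ.map Φ) := by
  refine ⟨fun y => ?_⟩
  obtain ⟨i, hi⟩ := hne y
  have hpos : 0 < ‖c i y‖₊ := nnnorm_pos.2 hi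
  have hU : IsOpen {z | ‖c i y‖₊ / 2 < ‖c i z‖₊} := isOpen_lt (by fun_prop) (hc i).nnnorm
  refine ⟨_, hU.mem_nhds (NNReal.half_lt_self hpos.ne'), ?_⟩
  rw [Measure.map_apply_of_aemeasurable hΦ hU.measurableSet]
  exact (measure_mono (Set.ofPred_subset_ofPred.2 fun _ => le_of_lt)).trans_lt
    ((hcp i).meas_ge_lt_top hp0 hp (half_pos hpos).ne')

end Support

section SdiffSingleton

variable {Z : Type*} [TopologicalSpace Z] {K : Set Z}

theorem locallyCompactSpace_sdiff_singleton [T2Space Z] (hK : IsCompact K) (z : Z) :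
    LocallyCompactSpace ↥(K \ {z}) := by
  have := isCompact_iff_compactSpace.1 hK
  refine (IsOpenEmbedding.inclusion Set.sdiff_subset ?_).locallyCompactSpace
  have : (Subtype.val ⁻¹' (K \ {z}) : Set K) = Subtype.val ⁻¹' {z}ᶜ := by
    ext x
    simp
  exact this ▸ isOpen_compl_singleton.preimage continuous_subtype_val

theorem polishSpace_sdiff_singleton [PolishSpace Z] (hK : IsClosed K) (z : Z) :
    PolishSpace ↥(K \ {z}) := by
  have : PolishSpace ↥({z}ᶜ : Set Z) := isOpen_compl_singleton.polishSpace
  refine (IsClosedEmbedding.inclusion (t := {z}ᶜ) (fun _ h => h.2) ?_).polishSpace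
  have : (Subtype.val ⁻¹' (K \ {z}) : Set ↥({z}ᶜ : Set Z)) = Subtype.val ⁻¹' K := by
    ext x
    simp
  exact this ▸ hK.preimage continuous_subtype_val

end SdiffSingleton

namespace BooleanAction

section Translate

variable {G X : Type*} [Group G] [MeasurableSpace G] [MeasurableSpace X] {μ : Measure X}
  (α : BooleanAction G X μ)

theorem act_one_ae : ∀ᵐ x ∂μ, α.act 1 x = x := by
  filter_upwards [α.act_mul_ae 1 1] with x hx
  rw [mul_one] at hx
  exact ((α.bijective_act 1).1 hx).symm

theorem ae_act {P : X → Prop} (g : G) (h : ∀ᵐ x ∂μ, P x) : ∀ᵐ x ∂μ, P (α.act g x) :=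
  (α.measurePreserving_act g).quasiMeasurePreserving.ae h

theorem coeFn_translate (g : G) (f : Lp ℂ ∞ μ) : α.translate g f =ᵐ[μ] f ∘ α.act g⁻¹ :=
  Lp.coeFn_compMeasurePreserving f (α.measurePreserving_act g⁻¹)

theorem norm_translate (g : G) (f : Lp ℂ ∞ μ) : ‖α.translate g f‖ = ‖f‖ :=
  Lp.norm_compMeasurePreserving f (α.measurePreserving_act g⁻¹)

theorem translate_sub (g : G) (f f' : Lp ℂ ∞ μ) :
    α.translate g (f - f') = α.translate g f - α.translate g f' :=
  map_sub _ f f'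

theorem translate_mul (g h : G) (f : Lp ℂ ∞ μ) :
    α.translate (g * h) f = α.translate g (α.translate h f) := by
  apply Lp.ext
  filter_upwards [α.coeFn_translate (g * h) f, α.coeFn_translate g (α.translate h f),
    α.ae_act g⁻¹ (α.coeFn_translate h f), α.act_mul_ae h⁻¹ g⁻¹] with x h₁ h₂ h₃ h₄
  rw [h₁, h₂, Function.comp_apply, Function.comp_apply, h₃, Function.comp_apply, mul_inv_rev, h₄]

theorem continuous_translate [TopologicalSpace G] [IsTopologicalGroup G] {f : Lp ℂ ∞ μ}
    (hf : f ∈ α.gContinuous) : Continuous fun g => α.translate g f := by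
  refine continuous_iff_continuousAt.2 fun h => tendsto_iff_norm_sub_tendsto_zero.2 ?_
  have hlim : Tendsto (fun g => h⁻¹ * g) (𝓝 h) (𝓝 1) := by
    simpa only [inv_mul_cancel] using (continuous_const_mul h⁻¹).tendsto h
  refine (hf.comp hlim).congr fun g => ?_
  calc ‖f - α.translate (h⁻¹ * g) f‖ = ‖α.translate h (f - α.translate (h⁻¹ * g) f)‖ :=
        (α.norm_translate h _).symm
    _ = ‖α.translate h f - α.translate g f‖ := by
        rw [translate_sub, ← translate_mul, mul_inv_cancel_left]
    _ = ‖α.translate g f - α.translate h f‖ := norm_sub_rev _ _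

end Translate

section Equivariant

variable {G X Y : Type*} [Group G] [MeasurableSpace G] [MeasurableSpace X] {μ : Measure X}
  {α : BooleanAction G X μ}

/-- The map `Φ : X → Y` intertwines the boolean action with a family `a` of self-maps of `Y`,
up to a null set depending on the group element. -/
def AEEquivariant (α : BooleanAction G X μ) (a : G → Y → Y) (Φ : X → Y) : Prop :=
  ∀ g, ∀ᵐ x ∂μ, Φ (α.act g x) = a g (Φ x)

theorem AEEquivariant.congr {a : G → Y → Y} {Φ Ψ : X → Y} (h : α.AEEquivariant a Φ)
    (hΨ : Ψ =ᵐ[μ] Φ) : α.AEEquivariant a Ψ := fun g => by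
  filter_upwards [h g, hΨ, α.ae_act g hΨ] with x h₁ h₂ h₃
  rw [h₃, h₁, h₂]

variable [TopologicalSpace Y] [MeasurableSpace Y] [OpensMeasurableSpace Y] {ν : Measure Y}
  [ν.IsOpenPosMeasure] {Φ : X → Y}

/-- On a model of full support, continuous self-maps intertwined with a boolean action satisfy the
action identities everywhere. -/
abbrev AEEquivariant.mulAction [T2Space Y] {a : G → Y → Y} (h : α.AEEquivariant a Φ)
    (hΦ : MeasurePreserving Φ μ ν) (ha : ∀ g, Continuous (a g)) : MulAction G Y where
  smul := a
  one_smul := congrFun <| eq_of_ae_comp_eq hΦ (ha 1) continuous_id <| by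
    filter_upwards [h 1, α.act_one_ae] with x h₁ h₂
    exact h₁.symm.trans (congrArg Φ h₂)
  mul_smul g k := congrFun <| eq_of_ae_comp_eq hΦ (ha (g * k)) ((ha g).comp (ha k)) <| by
    filter_upwards [h (g * k), h k, α.ae_act k (h g), α.act_mul_ae g k] with x h₁ h₂ h₃ h₄
    exact h₁.symm.trans ((congrArg Φ h₄).trans (h₃.trans (congrArg (a g) h₂)))

theorem exists_continuous_eq_comp_act [TopologicalSpace G] [IsTopologicalGroup G] [BorelSpace Y]
    {f : Lp ℂ ∞ μ} (hf : f ∈ α.gContinuous) (hΦ : MeasurePreserving Φ μ ν) {κ : Type*}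
    {γ : κ → G} (hγ : DenseRange γ) {c : κ → Y → ℂ} (hc : ∀ k, Continuous (c k))
    (hcf : ∀ k, ∀ᵐ x ∂μ, c k (Φ x) = f (α.act (γ k) x)) :
    ∃ E : G → BoundedContinuousFunction Y ℂ, Continuous E ∧
      (∀ g, ∀ᵐ x ∂μ, E g (Φ x) = f (α.act g x)) ∧ ∀ k, E (γ k) = c k := by
  have hiso := isometry_pullbackLinfty (E := ℂ) hΦ
  have htr : Continuous fun g => α.translate g⁻¹ f :=
    (α.continuous_translate hf).comp continuous_inv
  have hcoe (g : G) : α.translate g⁻¹ f =ᵐ[μ] f ∘ α.act g := by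
    simpa only [inv_inv] using α.coeFn_translate g⁻¹ f
  have hmem (g : G) : α.translate g⁻¹ f ∈ Set.range (pullbackLinfty hΦ) :=
    hγ.induction_on g (hiso.isClosedEmbedding.isClosed_range.preimage htr) fun k =>
      mem_range_pullbackLinfty hΦ (hc k) (EventuallyEq.trans (hcf k) (hcoe (γ k)).symm)
  choose E hE using hmem
  have hEf (g : G) : ∀ᵐ x ∂μ, E g (Φ x) = f (α.act g x) :=
    (coeFn_pullbackLinfty hΦ (E g)).symm.trans (by rw [hE g]; exact hcoe g)
  have hEc : Continuous E := hiso.isEmbedding.continuous_iff.2 (htr.congr fun g => (hE g).symm)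
  refine ⟨E, hEc, hEf, fun k => ?_⟩
  refine eq_of_ae_comp_eq hΦ (E (γ k)).continuous (hc k) ?_
  filter_upwards [hEf (γ k), hcf k] with x h₁ h₂
  rw [h₁, h₂]

end Equivariant

section TranslateSpectrum

variable {G X ι κ : Type*} [Group G] [MeasurableSpace G] [MeasurableSpace X] {μ : Measure X}

/-- The family of the functions `f i ∘ α(γ k, ·)`, as a single map into `ℂ ^ (ι × κ)`. -/
noncomputable def translates (α : BooleanAction G X μ) (f : ι → Lp ℂ ∞ μ) (γ : κ → G) (x : X) :
    ι × κ → ℂ :=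
  fun i => f i.1 (α.act (γ i.2) x)

/-- The nonzero part of the joint essential range of the functions `f i ∘ α(γ k, ·)`. It is the
Gelfand spectrum of the (possibly non-unital) C*-subalgebra of `L^∞` which they generate. -/
def translateSpectrum (α : BooleanAction G X μ) (f : ι → Lp ℂ ∞ μ) (γ : κ → G) :
    Set (ι × κ → ℂ) :=
  (μ.map (α.translates f γ)).support \ {0}

variable {α : BooleanAction G X μ} {f : ι → Lp ℂ ∞ μ} {γ : κ → G}

theorem measurable_translates : Measurable (α.translates f γ) :=
  measurable_pi_lambda _ fun _ => (Lp.stronglyMeasurable _).measurable.comp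
    (α.measurePreserving_act _).measurable

theorem memLp_translates_apply {p : ℝ≥0∞} (hf : ∀ i, MemLp (f i) p μ) (i : ι × κ) :
    MemLp (fun x => α.translates f γ x i) p μ :=
  (hf i.1).comp_measurePreserving (α.measurePreserving_act (γ i.2))

theorem ae_translates_ne_zero [Nonempty κ] (hf : ∀ᵐ x ∂μ, ∃ i, f i x ≠ 0) :
    ∀ᵐ x ∂μ, α.translates f γ x ≠ 0 := by
  obtain ⟨k⟩ := ‹Nonempty κ›
  filter_upwards [α.ae_act (γ k) hf] with x ⟨i, hi⟩
  exact Function.ne_iff.2 ⟨(i, k), hi⟩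

theorem exists_injOn_translates [Nonempty κ] {s : Set X} (hs : s ∈ ae μ)
    (hinj : s.InjOn fun x i => f i x) : ∃ t ∈ ae μ, t.InjOn (α.translates f γ) := by
  obtain ⟨k⟩ := ‹Nonempty κ›
  refine ⟨α.act (γ k) ⁻¹' s, α.ae_act (γ k) hs, fun x hx y hy hxy => ?_⟩
  exact (α.bijective_act (γ k)).1 (hinj hx hy (funext fun i => congrFun hxy (i, k)))

variable [Countable ι] [Countable κ]

theorem locallyCompactSpace_translateSpectrum :
    LocallyCompactSpace (α.translateSpectrum f γ) :=
  locallyCompactSpace_sdiff_singleton (isCompact_support_map_of_ae_norm_le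
    measurable_translates.aemeasurable fun _ => α.ae_act _ (ae_norm_le_norm_top _)) 0

theorem polishSpace_translateSpectrum : PolishSpace (α.translateSpectrum f γ) :=
  polishSpace_sdiff_singleton Measure.isClosed_support 0

theorem exists_continuous_aeEquivariant [TopologicalSpace G] [IsTopologicalGroup G]
    (hf : ∀ i, f i ∈ α.gContinuous) (hγ : DenseRange γ) {Φ : X → α.translateSpectrum f γ}
    {ν : Measure (α.translateSpectrum f γ)} [ν.IsOpenPosMeasure] (hΦ : MeasurePreserving Φ μ ν)
    (hΦf : ∀ᵐ x ∂μ, (Φ x : ι × κ → ℂ) = α.translates f γ x) :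
    ∃ a : G → α.translateSpectrum f γ → α.translateSpectrum f γ,
      Continuous (fun q : G × α.translateSpectrum f γ => a q.1 q.2) ∧ α.AEEquivariant a Φ := by
  have hcoord (i : ι × κ) : Continuous fun y : α.translateSpectrum f γ => y.1 i :=
    (continuous_apply i).comp continuous_subtype_val
  choose E hEc hEf hEγ using fun i => exists_continuous_eq_comp_act (hf i) hΦ hγ
    (fun k => hcoord (i, k)) fun k => hΦf.mono fun x hx => congrFun hx (i, k)
  let b (g : G) (y : α.translateSpectrum f γ) : ι × κ → ℂ := fun i => E i.1 (γ i.2 * g) y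
  have hb : Continuous fun q : G × α.translateSpectrum f γ => b q.1 q.2 := continuous_pi fun i =>
    ((hEc i.1).comp (continuous_fst.const_mul (γ i.2))).eval continuous_snd
  have hbΦ (g : G) : ∀ᵐ x ∂μ, (Φ (α.act g x) : ι × κ → ℂ) = b g (Φ x) := by
    filter_upwards [α.ae_act g hΦf, ae_all_iff.2 fun i : ι × κ => hEf i.1 (γ i.2 * g),
      ae_all_iff.2 fun i : ι × κ => α.act_mul_ae (γ i.2) g] with x h₁ h₂ h₃
    rw [h₁]
    exact funext fun i => by rw [translates, ← h₃, ← h₂]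
  have hsupp (g : G) (y) : b g y ∈ (μ.map (α.translates f γ)).support :=
    have hbg : Continuous (b g) := hb.comp (.prodMk_right g)
    mem_of_ae_comp_mem hΦ (Measure.isClosed_support.preimage hbg) (by
      filter_upwards [hbΦ g] with x hx
      rw [Set.mem_preimage, ← hx]
      exact (Φ (α.act g x)).2.1) y
  -- if all the coordinates `(i, γ k g)` of `y` vanish, then so do its coordinates `(i, γ k)`,
  -- by continuity in the group variable
  have hne (g : G) (y) : b g y ≠ 0 := fun h => y.2.2 <| funext fun i => by
    have hzero (k : G) : E i.1 k y = 0 :=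
      ((Homeomorph.mulRight g).surjective.denseRange.comp hγ (by fun_prop)).induction_on k
        (isClosed_singleton.preimage ((hEc i.1).eval_const y)) fun k => congrFun h (i.1, k)
    exact (congrFun (hEγ i.1 i.2) y).symm.trans (hzero (γ i.2))
  exact ⟨fun g y => ⟨b g y, hsupp g y, hne g y⟩, hb.subtype_mk _, fun g =>
    (hbΦ g).mono fun x hx => Subtype.ext hx⟩

end TranslateSpectrum

end BooleanAction

namespace BooleanAction

section Lift

variable {G X : Type*} [Group G] [TopologicalSpace G] [MeasurableSpace G] [OpensMeasurableSpace G]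
  [MeasurableSpace X] {μ : Measure X} {α : BooleanAction G X μ}

theorem liftsToContinuousRadon_of_ae_eq_smul [TopologicalSpace X] [PolishSpace X]
    [LocallyCompactSpace X] [BorelSpace X] [IsLocallyFiniteMeasure μ] [MulAction G X]
    [ContinuousSMul G X] (h : ∀ g, (fun x => g • x) =ᵐ[μ] α.act g) :
    α.LiftsToContinuousRadon := by
  let β : BooleanAction G X μ :=
    { act := fun g x => g • x
      measurable_act := continuous_smul.measurable
      act_mul_ae := fun g k => ae_of_all _ (mul_smul g k)
      bijective_act := MulAction.bijective
      measurePreserving_act := fun g => ⟨(continuous_const_smul g).measurable, by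
        rw [Measure.map_congr (h g), (α.measurePreserving_act g).map_eq]⟩ }
  exact ⟨_, inferInstance, inferInstance, inferInstance, inferInstance, β,
    ⟨⟨one_smul G, mul_smul⟩, continuous_smul⟩, h⟩

variable {Y : Type*} [TopologicalSpace Y] [PolishSpace Y] [LocallyCompactSpace Y] [MulAction G Y]
  [ContinuousSMul G Y] [MeasurableSpace Y] [BorelSpace Y]

theorem AEEquivariant.liftsToContinuousRadon_of_measurableEquiv {e : X ≃ᵐ Y}
    [IsLocallyFiniteMeasure (μ.map e)] (he : α.AEEquivariant (fun g y => g • y) e) :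
    α.LiftsToContinuousRadon := by
  let _ : TopologicalSpace X := .induced e inferInstance
  let h : X ≃ₜ Y := e.toEquiv.toHomeomorphOfIsInducing ⟨rfl⟩
  have : PolishSpace X := h.isClosedEmbedding.polishSpace
  have : LocallyCompactSpace X := h.isClosedEmbedding.locallyCompactSpace
  have : BorelSpace X :=
    ⟨e.measurableEmbedding.comap_eq.symm.trans ((congrArg (MeasurableSpace.comap h)
      (BorelSpace.measurable_eq (α := Y))).trans borel_comap.symm)⟩
  have : IsLocallyFiniteMeasure μ := ⟨fun x => by
    obtain ⟨U, hU, hUf⟩ := (μ.map e).finiteAt_nhds (e x)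
    exact ⟨e ⁻¹' U, h.continuous.continuousAt hU, by rwa [e.map_apply] at hUf⟩⟩
  let _ : MulAction G X := h.toEquiv.mulAction G
  have : ContinuousSMul G X :=
    ⟨h.symm.continuous.comp (continuous_fst.smul (h.continuous.comp continuous_snd))⟩
  refine liftsToContinuousRadon_of_ae_eq_smul fun g => ?_
  filter_upwards [he g] with x hx
  exact (h.symm_apply_eq).2 hx.symm

theorem AEEquivariant.liftsToContinuousRadon_of_injOn [StandardBorelSpace X] [SFinite μ]
    [NullSingletonClass μ] (hμ : μ ≠ 0) {Φ : X → Y} (hequi : α.AEEquivariant (fun g y => g • y) Φ)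
    (hΦ : Measurable Φ) [IsLocallyFiniteMeasure (μ.map Φ)] {s : Set X} (hs : s ∈ ae μ)
    (hinj : s.InjOn Φ) : α.LiftsToContinuousRadon := by
  obtain ⟨e, he⟩ := exists_measurableEquiv_ae_eq hμ hΦ hs hinj
  have : IsLocallyFiniteMeasure (μ.map e) := by rwa [Measure.map_congr he]
  exact (hequi.congr he).liftsToContinuousRadon_of_measurableEquiv

end Lift

section Dense

variable {G X : Type*} [Group G] [TopologicalSpace G] [MeasurableSpace G] [MeasurableSpace X]
  {μ : Measure X} {α : BooleanAction G X μ} {p : ℝ≥0∞}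

theorem mem_gContinuousInter_iff {h : Lp ℂ p μ} :
    h ∈ α.gContinuousInter p ↔ ∃ f ∈ α.gContinuous, f =ᵐ[μ] h :=
  exists_congr fun _ => and_congr_right fun _ => AEEqFun.ext_iff

theorem exists_seq_gContinuous_tendsto_ae [Fact (1 ≤ p)] (hd : Dense (α.gContinuousInter p))
    {u : X → ℂ} (hu : MemLp u p μ) :
    ∃ f : ℕ → Lp ℂ ∞ μ, (∀ n, f n ∈ α.gContinuous) ∧ (∀ n, MemLp (f n) p μ) ∧
      ∀ᵐ x ∂μ, Tendsto (fun n => f n x) atTop (𝓝 (u x)) := by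
  obtain ⟨h, hh, hlim⟩ := mem_closure_iff_seq_limit.1 (hd hu.toLp)
  obtain ⟨n, -, hn⟩ := (tendstoInMeasure_of_tendsto_Lp hlim).exists_seq_tendsto_ae
  choose f hf hfh using fun k => mem_gContinuousInter_iff.1 (hh (n k))
  refine ⟨f, hf, fun k => (Lp.memLp (h (n k))).ae_eq (hfh k).symm, ?_⟩
  filter_upwards [hn, hu.coeFn_toLp, ae_all_iff.2 hfh] with x h₁ h₂ h₃
  simpa only [h₂, h₃] using h₁

theorem exists_seq_gContinuous_injOn [StandardBorelSpace X] [SigmaFinite μ] [Fact (1 ≤ p)]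
    (hp : p ≠ ∞) (hd : Dense (α.gContinuousInter p)) :
    ∃ f : ℕ → Lp ℂ ∞ μ, (∀ n, f n ∈ α.gContinuous) ∧ (∀ n, MemLp (f n) p μ) ∧
      (∀ᵐ x ∂μ, ∃ n, f n x ≠ 0) ∧ ∃ s ∈ ae μ, s.InjOn fun x n => f n x := by
  have hp0 : p ≠ 0 := (zero_lt_one.trans_le (Fact.out : 1 ≤ p)).ne'
  obtain ⟨u, hui, hu0, hu⟩ := exists_injective_ne_zero_memLp μ hp0 hp
  obtain ⟨f, hf, hfp, hfu⟩ := exists_seq_gContinuous_tendsto_ae hd hu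
  refine ⟨f, hf, hfp, ?_, _, hfu, fun x hx y hy hxy => hui ?_⟩
  · filter_upwards [hfu] with x hx
    by_contra! h
    simp only [h] at hx
    exact hu0 x (tendsto_nhds_unique hx tendsto_const_nhds)
  · exact tendsto_nhds_unique hx (hy.congr fun n => (congrFun hxy n).symm)

theorem liftsToContinuousRadon_of_dense [IsTopologicalGroup G]
    [TopologicalSpace.SeparableSpace G] [OpensMeasurableSpace G] [StandardBorelSpace X]
    [SigmaFinite μ] [NullSingletonClass μ] (hμ : μ ≠ 0) [Fact (1 ≤ p)] (hp : p ≠ ∞)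
    (hd : Dense (α.gContinuousInter p)) : α.LiftsToContinuousRadon := by
  have hp0 : p ≠ 0 := (zero_lt_one.trans_le (Fact.out : 1 ≤ p)).ne'
  obtain ⟨f, hf, hfp, hf0, s, hs, hinj⟩ := exists_seq_gContinuous_injOn hp hd
  let γ : ℕ → G := TopologicalSpace.denseSeq G
  have hγ : DenseRange γ := TopologicalSpace.denseRange_denseSeq G
  let Y := α.translateSpectrum f γ
  have hF : AEMeasurable (α.translates f γ) μ := measurable_translates.aemeasurable
  obtain ⟨Φ, hΦ, hΦF⟩ : ∃ Φ : X → Y, Measurable Φ ∧ ∀ᵐ x ∂μ, (Φ x : ℕ × ℕ → ℂ) =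
      α.translates f γ x :=
    exists_measurable_subtype_ae_eq hμ hF ((ae_mem_support_map hF).and (ae_translates_ne_zero hf0))
  have : LocallyCompactSpace Y := locallyCompactSpace_translateSpectrum
  have : PolishSpace Y := polishSpace_translateSpectrum
  have : (μ.map Φ).IsOpenPosMeasure :=
    isOpenPosMeasure_map_of_subset_support hF Set.sdiff_subset hΦ.aemeasurable hΦF
  have : IsLocallyFiniteMeasure (μ.map Φ) :=
    isLocallyFiniteMeasure_map_of_memLp hΦ.aemeasurable hp0 hp (c := fun i (y : Y) => y.1 i)
      (fun i => (continuous_apply i).comp continuous_subtype_val)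
      (fun i => (memLp_translates_apply hfp i).ae_eq
        (hΦF.mono fun x hx => (congrFun hx i).symm)) fun y => Function.ne_iff.1 y.2.2
  have hmp : MeasurePreserving Φ μ (μ.map Φ) := hΦ.measurePreserving μ
  obtain ⟨a, ha, hequi⟩ := exists_continuous_aeEquivariant hf hγ hmp hΦF
  let _ : MulAction G Y := hequi.mulAction hmp fun g => ha.comp (.prodMk_right g)
  have : ContinuousSMul G Y := ⟨ha⟩
  obtain ⟨t, ht, htinj⟩ := exists_injOn_translates (γ := γ) hs hinj
  exact AEEquivariant.liftsToContinuousRadon_of_injOn hμ hequi hΦ (inter_mem ht hΦF)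
    fun x hx y hy hxy => htinj hx.1 hy.1 (hx.2.symm.trans ((congrArg Subtype.val hxy).trans hy.2))

end Dense

end BooleanAction

section CompactSupport

theorem eventually_norm_sub_inv_smul_le {G Y E : Type*} [Group G] [TopologicalSpace G]
    [IsTopologicalGroup G] [TopologicalSpace Y] [MulAction G Y] [ContinuousSMul G Y]
    [SeminormedAddCommGroup E] {f : Y → E} (hf : Continuous f) (hfc : HasCompactSupport f) {ε : ℝ}
    (hε : 0 < ε) : ∀ᶠ g in 𝓝 (1 : G), ∀ y, ‖f y - f (g⁻¹ • y)‖ ≤ ε := by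
  have hcont : Continuous fun q : G × Y => ‖f q.2 - f (q.1 • q.2)‖ := by fun_prop
  have h : ∀ᶠ g in 𝓝 (1 : G), ∀ y ∈ tsupport f, ‖f y - f (g • y)‖ < ε :=
    hfc.isCompact.eventually_forall_of_forall_eventually fun y _ =>
      hcont.continuousAt.eventually (isOpen_Iio.mem_nhds (by simpa using hε))
  have hinv : Tendsto (fun g : G => g⁻¹) (𝓝 1) (𝓝 1) := by
    simpa only [inv_one] using (continuous_inv (G := G)).tendsto 1
  filter_upwards [h, hinv.eventually h] with g hg hg' y
  by_cases hy : y ∈ tsupport f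
  · exact (hg' y hy).le
  by_cases hz : g⁻¹ • y ∈ tsupport f
  · simpa only [smul_inv_smul, norm_sub_rev] using (hg _ hz).le
  · rw [image_eq_zero_of_notMem_tsupport hy, image_eq_zero_of_notMem_tsupport hz, sub_zero,
      norm_zero]
    exact hε.le

theorem dense_setOf_ae_eq_hasCompactSupport {Y E : Type*} [TopologicalSpace Y] [NormalSpace Y]
    [R1Space Y] [WeaklyLocallyCompactSpace Y] [MeasurableSpace Y] [BorelSpace Y]
    {η : Measure Y} [η.Regular] [NormedAddCommGroup E] [NormedSpace ℝ E] {p : ℝ≥0∞}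
    [Fact (1 ≤ p)] (hp : p ≠ ∞) :
    Dense {k : Lp E p η | ∃ f : Y → E, k =ᵐ[η] f ∧ HasCompactSupport f ∧ Continuous f} := by
  refine fun k => mem_closure_iff_nhds_basis Metric.nhds_basis_closedBall |>.2 fun ε hε => ?_
  obtain ⟨f, hfc, hkf, hf, hfp⟩ := (Lp.memLp k).exists_hasCompactSupport_eLpNorm_sub_le hp
    (ε := ENNReal.ofReal ε) (by simpa using hε)
  refine ⟨hfp.toLp, ⟨f, hfp.coeFn_toLp, hfc, hf⟩, ?_⟩
  rw [Metric.mem_closedBall, dist_comm, Lp.dist_def,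
    eLpNorm_congr_ae ((ae_eq_refl k).sub hfp.coeFn_toLp)]
  exact ENNReal.toReal_le_of_le_ofReal hε.le hkf

end CompactSupport

section AlmostInvertible

variable {X Y : Type*} [MeasurableSpace X] [MeasurableSpace Y] {μ : Measure X} {η : Measure Y}

theorem measurePreserving_subtype_coe_of_ae_mem {s : Set X} (hs : MeasurableSet s)
    (h : ∀ᵐ x ∂μ, x ∈ s) : MeasurePreserving (Subtype.val : s → X) (μ.comap Subtype.val) μ := by
  simpa only [Measure.restrict_eq_self_of_ae_mem h] using measurePreserving_subtype_coe (μa := μ) hs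

theorem exists_measurePreserving_extend [StandardBorelSpace X]
    [MeasurableSpace.CountablySeparated Y] (hμ : μ ≠ 0) {X₀ : Set X} (hX₀ : MeasurableSet X₀)
    (hX₀μ : ∀ᵐ x ∂μ, x ∈ X₀) {φ : X₀ → Y} (hφ : MeasurePreserving φ (μ.comap Subtype.val) η)
    (hinj : Function.Injective φ) :
    ∃ (Φ : X → Y) (Ψ : Y → X), MeasurePreserving Φ μ η ∧ MeasurePreserving Ψ η μ ∧
      Ψ ∘ Φ =ᵐ[μ] id ∧ ∀ x : X₀, Φ x = φ x := by
  have : NeBot (ae μ) := ae_neBot.2 hμ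
  obtain ⟨x₀, hx₀⟩ := hX₀μ.exists
  have : StandardBorelSpace X₀ := hX₀.standardBorel
  have hmap := (measurePreserving_subtype_coe_of_ae_mem hX₀ hX₀μ).map_eq
  obtain ⟨Φ, hΦ, hΦφ⟩ := (MeasurableEmbedding.subtype_coe hX₀).exists_measurable_extend
    hφ.measurable fun _ => ⟨φ ⟨x₀, hx₀⟩⟩
  obtain ⟨Ψ, hΨ, hΨφ⟩ := (hφ.measurable.measurableEmbedding hinj).exists_measurable_extend
    measurable_subtype_coe fun _ => ⟨x₀⟩
  have hΦμ : μ.map Φ = η := by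
    rw [← hmap, Measure.map_map hΦ measurable_subtype_coe, hΦφ, hφ.map_eq]
  have hinv : Ψ ∘ Φ =ᵐ[μ] id := by
    filter_upwards [hX₀μ] with x hx
    exact (congrArg Ψ (congrFun hΦφ ⟨x, hx⟩)).trans (congrFun hΨφ ⟨x, hx⟩)
  have hΨη : η.map Ψ = μ := by
    rw [← hΦμ, Measure.map_map hΨ hΦ, Measure.map_congr hinv, Measure.map_id]
  exact ⟨Φ, Ψ, ⟨hΦ, hΦμ⟩, ⟨hΨ, hΨη⟩, hinv, congrFun hΦφ⟩

theorem surjective_compMeasurePreserving {E : Type*} [NormedAddCommGroup E] {p : ℝ≥0∞} {Φ : X → Y}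
    {Ψ : Y → X} (hΦ : MeasurePreserving Φ μ η) (hΨ : MeasurePreserving Ψ η μ)
    (hinv : Ψ ∘ Φ =ᵐ[μ] id) :
    Function.Surjective (Lp.compMeasurePreserving Φ hΦ : Lp E p η → Lp E p μ) := fun k => by
  refine ⟨Lp.compMeasurePreserving Ψ hΨ k, Lp.ext ?_⟩
  filter_upwards [Lp.coeFn_compMeasurePreserving (Lp.compMeasurePreserving Ψ hΨ k) hΦ,
    hΦ.quasiMeasurePreserving.ae (Lp.coeFn_compMeasurePreserving k hΨ), hinv] with x h₁ h₂ h₃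
  exact h₁.trans (h₂.trans (congrArg k h₃))

end AlmostInvertible

namespace BooleanAction

section Isomorphism

variable {G X Y : Type*} [Group G] [MeasurableSpace G] [MeasurableSpace X] [MeasurableSpace Y]
  {μ : Measure X} {η : Measure Y}

theorem booleanlyIsomorphic_of_ae_eq {α β : BooleanAction G X μ}
    (h : ∀ g, β.act g =ᵐ[μ] α.act g) : α.BooleanlyIsomorphic β := by
  have hmp := measurePreserving_subtype_coe_of_ae_mem (μ := μ) .univ (ae_of_all _ Set.mem_univ)
  refine ⟨Set.univ, Subtype.val, .univ, by simp, Subtype.val_injective, hmp, fun g => ?_⟩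
  filter_upwards [hmp.quasiMeasurePreserving.ae (h g)] with x hx
  exact ⟨Set.mem_univ _, hx.symm⟩

theorem BooleanlyIsomorphic.exists_measurePreserving [StandardBorelSpace X]
    [MeasurableSpace.CountablySeparated Y] (hμ : μ ≠ 0) {α : BooleanAction G X μ}
    {β : BooleanAction G Y η} (h : α.BooleanlyIsomorphic β) :
    ∃ (Φ : X → Y) (Ψ : Y → X), MeasurePreserving Φ μ η ∧ MeasurePreserving Ψ η μ ∧
      Ψ ∘ Φ =ᵐ[μ] id ∧ α.AEEquivariant β.act Φ := by
  obtain ⟨X₀, φ, hX₀, hX₀c, hinj, hφ, hequi⟩ := h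
  have hX₀μ : ∀ᵐ x ∂μ, x ∈ X₀ := hX₀c
  obtain ⟨Φ, Ψ, hΦ, hΨ, hinv, hΦφ⟩ := exists_measurePreserving_extend hμ hX₀ hX₀μ hφ hinj
  refine ⟨Φ, Ψ, hΦ, hΨ, hinv, fun g => ?_⟩
  suffices h : ∀ᵐ x ∂(μ.comap (Subtype.val : X₀ → X)).map Subtype.val,
      Φ (α.act g x) = β.act g (Φ x) by
    rwa [(measurePreserving_subtype_coe_of_ae_mem hX₀ hX₀μ).map_eq] at h
  rw [(MeasurableEmbedding.subtype_coe hX₀).ae_map_iff]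
  filter_upwards [hequi g] with x ⟨hx, hφx⟩
  rw [hΦφ x, ← hφx, ← hΦφ ⟨_, hx⟩]

/-- The group action underlying a spatial boolean action. -/
abbrev IsSpatial.mulAction {α : BooleanAction G X μ} (h : α.IsSpatial) : MulAction G X where
  smul := α.act
  one_smul := h.1
  mul_smul := h.2

end Isomorphism

section Model

variable {G X Y : Type*} [Group G] [TopologicalSpace G] [IsTopologicalGroup G] [MeasurableSpace G]
  [MeasurableSpace X] {μ : Measure X} [TopologicalSpace Y] [MulAction G Y] [ContinuousSMul G Y]
  {α : BooleanAction G X μ} {Φ : X → Y}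

theorem AEEquivariant.toLp_comp_mem_gContinuous (hequi : α.AEEquivariant (fun g y => g • y) Φ)
    {f : Y → ℂ} (hf : Continuous f) (hfc : HasCompactSupport f) (hfΦ : MemLp (f ∘ Φ) ∞ μ) :
    hfΦ.toLp ∈ α.gContinuous := by
  refine Metric.tendsto_nhds.2 fun ε hε => ?_
  filter_upwards [eventually_norm_sub_inv_smul_le hf hfc (half_pos hε)] with g hg
  rw [dist_zero_right, norm_norm]
  refine (norm_le_of_ae_norm_le_top (half_pos hε).le ?_).trans_lt (half_lt_self hε)
  filter_upwards [Lp.coeFn_sub hfΦ.toLp (α.translate g hfΦ.toLp), hfΦ.coeFn_toLp,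
    α.coeFn_translate g hfΦ.toLp, α.ae_act g⁻¹ hfΦ.coeFn_toLp, hequi g⁻¹] with x h₁ h₂ h₃ h₄ h₅
  rw [h₁, Pi.sub_apply, h₂, h₃, Function.comp_apply, Function.comp_apply, h₄, Function.comp_apply,
    h₅]
  exact hg (Φ x)

theorem AEEquivariant.compMeasurePreserving_mem_gContinuousInter [MeasurableSpace Y]
    [OpensMeasurableSpace Y] {η : Measure Y} (hequi : α.AEEquivariant (fun g y => g • y) Φ)
    (hΦ : MeasurePreserving Φ μ η) {f : Y → ℂ} (hf : Continuous f) (hfc : HasCompactSupport f)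
    {p : ℝ≥0∞} {k : Lp ℂ p η} (hk : k =ᵐ[η] f) :
    Lp.compMeasurePreserving Φ hΦ k ∈ α.gContinuousInter p := by
  obtain ⟨c, hc⟩ := hfc.exists_bound_of_continuous hf
  have hfΦ : MemLp (f ∘ Φ) ∞ μ := memLp_top_of_bound
    (hf.measurable.comp hΦ.measurable).aestronglyMeasurable c (ae_of_all _ fun x => hc (Φ x))
  refine mem_gContinuousInter_iff.2 ⟨_, hequi.toLp_comp_mem_gContinuous hf hfc hfΦ, ?_⟩
  filter_upwards [hfΦ.coeFn_toLp, Lp.coeFn_compMeasurePreserving k hΦ,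
    hΦ.quasiMeasurePreserving.ae hk] with x h₁ h₂ h₃
  rw [h₁, h₂, Function.comp_apply, Function.comp_apply, h₃]

end Model

section RadonModel

variable {G : Type v} {X : Type u} [Group G] [TopologicalSpace G] [MeasurableSpace G]
  [MeasurableSpace X] {μ : Measure X} {α : BooleanAction G X μ}

theorem LiftsToContinuousRadon.admitsContinuousRadonModel (h : α.LiftsToContinuousRadon) :
    α.AdmitsContinuousRadonModel := by
  obtain ⟨τ, hP, hL, hB, hR, β, hβ, hαβ⟩ := h
  exact ⟨X, τ, _, μ, β, hP, hL, hB, hR, hβ, booleanlyIsomorphic_of_ae_eq hαβ⟩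

theorem AdmitsContinuousRadonModel.dense_gContinuousInter [IsTopologicalGroup G]
    [StandardBorelSpace X] (hμ : μ ≠ 0) (h : α.AdmitsContinuousRadonModel) {p : ℝ≥0∞}
    [Fact (1 ≤ p)] (hp : p ≠ ∞) : Dense (α.gContinuousInter p) := by
  obtain ⟨Y, _, _, η, β, _, _, _, _, ⟨hβ, hβc⟩, hiso⟩ := h
  obtain ⟨Φ, Ψ, hΦ, hΨ, hinv, hequi⟩ := hiso.exists_measurePreserving hμ
  let _ : MulAction G Y := hβ.mulAction
  have : ContinuousSMul G Y := ⟨hβc⟩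
  refine ((surjective_compMeasurePreserving hΦ hΨ hinv).denseRange.dense_image
    (Lp.isometry_compMeasurePreserving hΦ).continuous
    (dense_setOf_ae_eq_hasCompactSupport hp)).mono ?_
  rintro _ ⟨k, ⟨f, hkf, hfc, hf⟩, rfl⟩
  exact AEEquivariant.compMeasurePreserving_mem_gContinuousInter hequi hΦ hf hfc hkf

end RadonModel

end BooleanAction

theorem theoremC_general {G : Type*} [Group G] [TopologicalSpace G] [IsTopologicalGroup G]
    [TopologicalSpace.SeparableSpace G] [MeasurableSpace G] [OpensMeasurableSpace G]
    {X : Type*} [MeasurableSpace X] [StandardBorelSpace X]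
    (μ : Measure X) [SigmaFinite μ] [NullSingletonClass μ] (hμ : μ ≠ 0)
    (α : BooleanAction G X μ) {p q : ℝ≥0∞} [Fact (1 ≤ p)] [Fact (1 ≤ q)] (hp : p ≠ ∞)
    (hq : q ≠ ∞) :
    List.TFAE [
      Dense (α.gContinuousInter p),
      Dense (α.gContinuousInter q),
      α.AdmitsContinuousRadonModel,
      α.LiftsToContinuousRadon] := by
  tfae_have 1 → 4 := BooleanAction.liftsToContinuousRadon_of_dense hμ hp
  tfae_have 2 → 4 := BooleanAction.liftsToContinuousRadon_of_dense hμ hq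
  tfae_have 4 → 3 := fun h => h.admitsContinuousRadonModel
  tfae_have 3 → 1 := fun h => h.dense_gContinuousInter hμ hp
  tfae_have 3 → 2 := fun h => h.dense_gContinuousInter hμ hq
  tfae_finish

theorem theoremC {G : Type*} [Group G] [TopologicalSpace G] [IsTopologicalGroup G] [PolishSpace G]
    [MeasurableSpace G] [BorelSpace G]
    {X : Type*} [MeasurableSpace X] [StandardBorelSpace X]
    (μ : Measure X) [SigmaFinite μ] [NullSingletonClass μ] (hμ : μ ≠ 0)
    (α : BooleanAction G X μ) :
    List.TFAE [
      Dense (α.gContinuousInter 1),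
      Dense (α.gContinuousInter 2),
      α.AdmitsContinuousRadonModel,
      α.LiftsToContinuousRadon] :=
  theoremC_general μ hμ α ENNReal.one_ne_top ENNReal.ofNat_ne_top
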